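/- Let $H$ be a real separable Hilbert space and let $B:H\to H$ be a bounded, self-adjoint, strictly positive ($\langle Bx,x\rangle>0$ for $x\neq 0$), compact operator. Let $H_{-1}$ be the completion of $H$ with respect to the norm $\|x\|_{-1}=\langle Bx,x\rangle^{1/2}$. For $X\in\{H,H_{-1}\}$ let $\mathcal P_p(X)$ be the set of Borel probability measures on $X$ with finite $p$-th moment; a measure $\mu\in\mathcal P_1(H)$ is regarded as an element of $\mathcal P_1(H_{-1})$ via $F\mapsto\mu(F\cap H)$. Let $\mathbf d_{1,-1}(\mu,\nu)=\inf_\gamma\int\|x-y\|_{-1}\,\gamma(\mathrm dx,\mathrm dy)$ be the Wasserstein distance on $\mathcal P_1(H_{-1})$, the infimum being over the Borel probability measures $\gamma$ on $H_{-1}\times H_{-1}$ with marginals $\mu,\nu$. Let $T>0$, $m_0\in\mathcal P_2(H)$, and let $c,M\ge 0$ be arbitrary constants. Put $$Q=\Big\{\mu\in\mathcal P_1(H):\int_H\|x\|^2\,\mu(\mathrm dx)\le c\Big\},$$ $$C_{m_0}=\Big\{m:[0,T]\to Q\;:\;m(0)=m_0,\ \ \mathbf d_{1,-1}(m(t),m(s))\le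 M\sqrt{|t-s|}\ \text{ for all } s,t\in[0,T]\Big\}.$$ Then every $m\in C_{m_0}$ belongs to $C([0,T];(\mathcal P_1(H_{-1}),\mathbf d_{1,-1}))$, the set $C_{m_0}$ is convex (with respect to pointwise-in-time convex combinations of measures), and it is compact in $C([0,T];(\mathcal P_1(H_{-1}),\mathbf d_{1,-1}))$ with the metric $\rho_{-1,\infty}(m_1,m_2)=\max_{t\in[0,T]}\mathbf d_{1,-1}(m_1(t),m_2(t))$. -/

import Mathlib

open MeasureTheory ProbabilityTheory Set Filter Topology
open scoped ENNReal NNReal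

noncomputable section

namespace HilbertFlow

/-! ### Probability measures with finite moments and the Wasserstein distance -/

/-- `PSpace p X` is `𝒫_p(X)`: Borel probability measures on `X` with finite `p`-th moment. -/
@[ext]
structure PSpace (p : ℝ) (X : Type*) [NormedAddCommGroup X] [MeasurableSpace X] where
  meas : Measure X
  isProb : IsProbabilityMeasure meas
  moment : ∫⁻ x, ‖x‖ₑ ^ p ∂meas < ∞

attribute [instance] PSpace.isProb

/-- Probability measures on `X × X` with marginals `μ` and `ν` (the total mass is `1` as soon as
that of `μ` is). -/
def couplings {X : Type*} [MeasurableSpace X] (μ ν : Measure X) : Set (Measure (X × X)) :=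
  {γ | γ.map Prod.fst = μ ∧ γ.map Prod.snd = ν}

/-- The infimum of `∫ ‖x - y‖ dγ(x, y)` over all couplings `γ`, as an extended real. -/
def transportCost {X : Type*} [NormedAddCommGroup X] [MeasurableSpace X] (μ ν : Measure X) :
    ℝ≥0∞ :=
  ⨅ γ ∈ couplings μ ν, ∫⁻ z, ‖z.1 - z.2‖ₑ ∂γ

section Wasserstein

variable {X : Type*} [NormedAddCommGroup X] [MeasurableSpace X]

theorem transportCost_le {μ ν : Measure X} {γ : Measure (X × X)} (h : γ ∈ couplings μ ν) :
    transportCost μ ν ≤ ∫⁻ z, ‖z.1 - z.2‖ₑ ∂γ :=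
  iInf₂_le γ h

variable [BorelSpace X] [SecondCountableTopology X]

theorem measurable_cost : Measurable (fun z : X × X => ‖z.1 - z.2‖ₑ) :=
  (measurable_fst.sub measurable_snd).enorm

theorem transportCost_ne_top (μ ν : PSpace 1 X) : transportCost μ.meas ν.meas ≠ ∞ := by
  have hmem : μ.meas.prod ν.meas ∈ couplings μ.meas ν.meas := by
    constructor
    · simp [Measure.map_fst_prod]
    · simp [Measure.map_snd_prod]
  refine ne_top_of_le_ne_top ?_ (transportCost_le hmem)
  have hμ : ∫⁻ x, ‖x‖ₑ ∂μ.meas < ∞ := by simpa using μ.moment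
  have hν : ∫⁻ x, ‖x‖ₑ ∂ν.meas < ∞ := by simpa using ν.moment
  have hle : ∫⁻ z, ‖z.1 - z.2‖ₑ ∂(μ.meas.prod ν.meas)
      ≤ ∫⁻ z, (‖z.1‖ₑ + ‖z.2‖ₑ) ∂(μ.meas.prod ν.meas) :=
    lintegral_mono fun z => enorm_sub_le
  refine (hle.trans_lt ?_).ne
  rw [lintegral_add_left measurable_fst.enorm]
  have h1 : ∫⁻ z, ‖z.1‖ₑ ∂(μ.meas.prod ν.meas) = ∫⁻ x, ‖x‖ₑ ∂μ.meas := by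
    rw [← hmem.1, lintegral_map measurable_enorm measurable_fst, hmem.1]
  have h2 : ∫⁻ z, ‖z.2‖ₑ ∂(μ.meas.prod ν.meas) = ∫⁻ x, ‖x‖ₑ ∂ν.meas := by
    rw [← hmem.2, lintegral_map measurable_enorm measurable_snd, hmem.2]
  rw [h1, h2]
  exact ENNReal.add_lt_top.2 ⟨hμ, hν⟩

theorem transportCost_self (μ : Measure X) : transportCost μ μ = 0 := by
  have hd : Measurable (fun x : X => (x, x)) := measurable_id.prodMk measurable_id
  have hmem : μ.map (fun x => (x, x)) ∈ couplings μ μ := by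
    constructor
    · rw [Measure.map_map measurable_fst hd]; exact Measure.map_id
    · rw [Measure.map_map measurable_snd hd]; exact Measure.map_id
  refine le_antisymm ((transportCost_le hmem).trans ?_) bot_le
  rw [lintegral_map measurable_cost hd]
  simp

theorem transportCost_comm_le (μ ν : Measure X) : transportCost μ ν ≤ transportCost ν μ := by
  refine le_iInf₂ fun γ hγ => ?_
  have hmem : γ.map Prod.swap ∈ couplings μ ν := by
    constructor
    · rw [Measure.map_map measurable_fst measurable_swap]; exact hγ.2
    · rw [Measure.map_map measurable_snd measurable_swap]; exact hγ.1
  refine (transportCost_le hmem).trans ?_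
  rw [lintegral_map measurable_cost measurable_swap]
  exact (lintegral_congr fun z => by simp [enorm_sub_rev]).le

/-- Triangle inequality, by gluing two couplings along the common marginal. -/
theorem transportCost_triangle [CompleteSpace X] (μ ν ρ : Measure X) [IsProbabilityMeasure μ] :
    transportCost μ ρ ≤ transportCost μ ν + transportCost ν ρ := by
  have key : ∀ γ ∈ couplings μ ν, ∀ η ∈ couplings ν ρ,
      transportCost μ ρ ≤ ∫⁻ z, ‖z.1 - z.2‖ₑ ∂γ + ∫⁻ z, ‖z.1 - z.2‖ₑ ∂η := by
    intro γ hγ η hη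
    have hprob : IsProbabilityMeasure γ := by
      refine ⟨?_⟩
      have := measure_univ (μ := μ)
      rwa [← hγ.1, Measure.map_apply measurable_fst MeasurableSet.univ, preimage_univ] at this
    have hη' : IsProbabilityMeasure η := by
      refine ⟨?_⟩
      have h1 : η univ = ν univ := by
        rw [← hη.1, Measure.map_apply measurable_fst MeasurableSet.univ, preimage_univ]
      have h2 : γ univ = ν univ := by
        rw [← hγ.2, Measure.map_apply measurable_snd MeasurableSet.univ, preimage_univ]
      rw [h1, ← h2, measure_univ]
    have hν' : IsFiniteMeasure ν := by rw [← hη.1]; infer_instance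
    set κ : Kernel X X := η.condKernel with hκ
    have hdis : ν ⊗ₘ κ = η := by
      have := η.disintegrate η.condKernel
      rwa [Measure.fst, hη.1] at this
    set π : Measure ((X × X) × X) := γ ⊗ₘ (κ.comap Prod.snd measurable_snd) with hπ
    have hf : Measurable (fun w : (X × X) × X => (w.1.1, w.2)) := by fun_prop
    have hg : Measurable (fun w : (X × X) × X => (w.1.2, w.2)) := by fun_prop
    have hπ1 : π.map Prod.fst = γ := Measure.fst_compProd _ _
    have hπ2 : π.map (fun w => (w.1.2, w.2)) = η := by
      refine Measure.ext fun s hs => ?_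
      rw [Measure.map_apply hg hs, hπ, Measure.compProd_apply (hg hs), ← hdis,
        Measure.compProd_apply hs, ← hγ.2,
        lintegral_map (Kernel.measurable_kernel_prodMk_left hs) measurable_snd]
      rfl
    have hmem : π.map (fun w => (w.1.1, w.2)) ∈ couplings μ ρ := by
      constructor
      · rw [Measure.map_map measurable_fst hf, ← hγ.1, ← hπ1,
          Measure.map_map measurable_fst measurable_fst]
        rfl
      · rw [Measure.map_map measurable_snd hf, ← hη.2, ← hπ2,
          Measure.map_map measurable_snd hg]
        rfl
    refine (transportCost_le hmem).trans ?_
    rw [lintegral_map measurable_cost hf]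
    have hγc : ∫⁻ z, ‖z.1 - z.2‖ₑ ∂γ = ∫⁻ w, ‖w.1.1 - w.1.2‖ₑ ∂π := by
      rw [← hπ1, lintegral_map measurable_cost measurable_fst]
    have hηc : ∫⁻ z, ‖z.1 - z.2‖ₑ ∂η = ∫⁻ w, ‖w.1.2 - w.2‖ₑ ∂π := by
      rw [← hπ2, lintegral_map measurable_cost hg]
    have hm : Measurable (fun w : (X × X) × X => ‖w.1.1 - w.1.2‖ₑ) :=
      measurable_cost.comp measurable_fst
    rw [hγc, hηc, ← lintegral_add_left hm]
    refine lintegral_mono fun w => ?_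
    have : w.1.1 - w.2 = (w.1.1 - w.1.2) + (w.1.2 - w.2) := by abel
    simp only [this]
    exact enorm_add_le _ _
  unfold transportCost at key ⊢
  simp only [ENNReal.iInf_add, ENNReal.add_iInf]
  exact le_iInf₂ fun η hη => le_iInf₂ fun γ hγ => key γ hγ η hη

theorem lintegral_le_of_transportCost_eq_zero {μ ν : Measure X} {K : ℝ≥0} {f : X → ℝ≥0}
    (hf : LipschitzWith K f) (h : transportCost μ ν = 0) : ∫⁻ x, f x ∂μ ≤ ∫⁻ x, f x ∂ν := by
  have hm : Measurable (fun x => (f x : ℝ≥0∞)) := hf.continuous.measurable.coe_nnreal_ennreal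
  have key : ∀ γ ∈ couplings μ ν,
      ∫⁻ x, f x ∂μ ≤ ∫⁻ x, f x ∂ν + K * ∫⁻ z, ‖z.1 - z.2‖ₑ ∂γ := by
    intro γ hγ
    have hm2 : Measurable (fun z : X × X => (f z.2 : ℝ≥0∞)) := hm.comp measurable_snd
    rw [← hγ.1, ← hγ.2, lintegral_map hm measurable_fst, lintegral_map hm measurable_snd,
      ← lintegral_const_mul _ measurable_cost, ← lintegral_add_left hm2]
    refine lintegral_mono fun z => ?_
    have h1 : f z.1 ≤ f z.2 + K * ‖z.1 - z.2‖₊ := by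
      have h2 := hf.dist_le_mul z.1 z.2
      have h3 : (f z.1 : ℝ) - f z.2 ≤ K * ‖z.1 - z.2‖ := by
        rw [NNReal.dist_eq, dist_eq_norm] at h2
        exact (le_abs_self _).trans h2
      rw [← NNReal.coe_le_coe]
      push_cast
      linarith
    calc (f z.1 : ℝ≥0∞) ≤ ((f z.2 + K * ‖z.1 - z.2‖₊ : ℝ≥0) : ℝ≥0∞) := ENNReal.coe_le_coe.2 h1
      _ = f z.2 + K * ‖z.1 - z.2‖ₑ := by rw [ENNReal.coe_add, ENNReal.coe_mul, enorm_eq_nnnorm]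
  refine ENNReal.le_of_forall_pos_le_add fun ε hε _ => ?_
  have hpos : (0 : ℝ≥0∞) < ((ε / (K + 1) : ℝ≥0) : ℝ≥0∞) := by
    exact_mod_cast div_pos hε (by positivity)
  rw [← h, transportCost] at hpos
  obtain ⟨γ, hγ⟩ := iInf_lt_iff.1 hpos
  obtain ⟨hγm, hγ⟩ := iInf_lt_iff.1 hγ
  refine (key γ hγm).trans ?_
  gcongr
  refine (mul_le_mul_right hγ.le _).trans ?_
  have h5 : K * (ε / (K + 1)) ≤ ε := by
    rw [← mul_div_assoc, div_le_iff₀ (by positivity), mul_comm]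
    gcongr
    exact le_self_add
  exact_mod_cast h5

theorem eq_of_transportCost_eq_zero {μ ν : Measure X} [IsProbabilityMeasure μ]
    [IsProbabilityMeasure ν] (h : transportCost μ ν = 0) : μ = ν := by
  have h' : transportCost ν μ = 0 := le_antisymm ((transportCost_comm_le ν μ).trans h.le) bot_le
  have hclosed : ∀ F : Set X, IsClosed F → μ F = ν F := by
    intro F hF
    have hpos : ∀ n : ℕ, 0 < 1 / ((n : ℝ) + 1) := fun n => Nat.one_div_pos_of_nat
    have hlim : Tendsto (fun n : ℕ => 1 / ((n : ℝ) + 1)) atTop (𝓝 0) :=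
      tendsto_one_div_add_atTop_nhds_zero_nat
    have h1 := tendsto_lintegral_thickenedIndicator_of_isClosed μ hF hpos hlim
    have h2 := tendsto_lintegral_thickenedIndicator_of_isClosed ν hF hpos hlim
    refine tendsto_nhds_unique h1 (h2.congr fun n => ?_)
    have hl := lipschitzWith_thickenedIndicator (hpos n) F
    refine le_antisymm ?_ ?_
    · exact lintegral_le_of_transportCost_eq_zero hl h'
    · exact lintegral_le_of_transportCost_eq_zero hl h
  refine ext_of_generate_finite _ (BorelSpace.measurable_eq.trans borel_eq_generateFrom_isClosed)
    isPiSystem_isClosed (fun F hF => hclosed F hF) (by simp)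

/-- `𝒫_1(X)` with the Wasserstein distance
`d_1(μ, ν) = inf_γ ∫ ‖x - y‖ dγ(x, y)`, for `X` complete and separable. -/
instance instMetricSpacePSpace [CompleteSpace X] : MetricSpace (PSpace 1 X) where
  dist μ ν := (transportCost μ.meas ν.meas).toReal
  dist_self μ := by simp [transportCost_self]
  dist_comm μ ν := congrArg ENNReal.toReal
    (le_antisymm (transportCost_comm_le _ _) (transportCost_comm_le _ _))
  dist_triangle μ ν ρ := by
    rw [← ENNReal.toReal_add (transportCost_ne_top μ ν) (transportCost_ne_top ν ρ)]
    exact ENNReal.toReal_mono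
      (ENNReal.add_ne_top.2 ⟨transportCost_ne_top μ ν, transportCost_ne_top ν ρ⟩)
      (transportCost_triangle _ _ _)
  eq_of_dist_eq_zero {μ ν} h := by
    rcases (ENNReal.toReal_eq_zero_iff _).1 h with h | h
    · exact PSpace.ext (eq_of_transportCost_eq_zero h)
    · exact absurd h (transportCost_ne_top μ ν)

end Wasserstein

/-! ### The space `H₋₁` -/

variable {H : Type*} [NormedAddCommGroup H] [InnerProductSpace ℝ H] [CompleteSpace H]

/-- A bounded, self-adjoint, strictly positive operator on `H`. -/
structure StrictlyPositiveOperator (H : Type*) [NormedAddCommGroup H] [InnerProductSpace ℝ H]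
    [CompleteSpace H] where
  op : H →L[ℝ] H
  isSelfAdjoint : IsSelfAdjoint op
  strictlyPositive : ∀ x : H, x ≠ 0 → 0 < inner ℝ (op x) x

/-- A copy of the vector space `H`, to be equipped with the inner product `⟨B x, y⟩`. -/
def PreWeak (_B : StrictlyPositiveOperator H) : Type _ := H

instance (B : StrictlyPositiveOperator H) : AddCommGroup (PreWeak B) :=
  inferInstanceAs (AddCommGroup H)

instance (B : StrictlyPositiveOperator H) : Module ℝ (PreWeak B) :=
  inferInstanceAs (Module ℝ H)

/-- The inner product `⟨x, y⟩₋₁ = ⟨B x, y⟩`. -/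
@[reducible]
def weakCore (B : StrictlyPositiveOperator H) : InnerProductSpace.Core ℝ (PreWeak B) where
  inner x y := inner ℝ (B.op (show H from x)) (show H from y)
  conj_inner_symm x y :=
    (real_inner_comm _ _).trans (B.isSelfAdjoint.isSymmetric (show H from x) (show H from y)).symm
  re_inner_nonneg x := by
    by_cases hx : (show H from x) = 0
    · exact (inner_zero_right (𝕜 := ℝ) (B.op (show H from x)) ▸ hx ▸ le_rfl :
        0 ≤ inner ℝ (B.op (show H from x)) (show H from x))
    · exact (B.strictlyPositive _ hx).le
  add_left x y z :=
    (congrArg (fun u => inner ℝ u (show H from z))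
      (map_add B.op (show H from x) (show H from y))).trans (inner_add_left _ _ _)
  smul_left x y r :=
    (congrArg (fun u => inner ℝ u (show H from y))
      (map_smul B.op r (show H from x))).trans (inner_smul_left _ _ _)
  definite x hx := by
    by_contra h
    exact (B.strictlyPositive _ h).ne' hx

instance (B : StrictlyPositiveOperator H) : NormedAddCommGroup (PreWeak B) :=
  (weakCore B).toNormedAddCommGroup

instance (B : StrictlyPositiveOperator H) : InnerProductSpace ℝ (PreWeak B) :=
  InnerProductSpace.ofCore (weakCore B).toCore

/-- `H₋₁`: the completion of `H` for the norm `‖x‖₋₁ = ⟨B x, x⟩^(1/2)`; a Hilbert space. -/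
abbrev WeakSpace (B : StrictlyPositiveOperator H) : Type _ := UniformSpace.Completion (PreWeak B)

instance (B : StrictlyPositiveOperator H) : MeasurableSpace (WeakSpace B) := borel _

instance (B : StrictlyPositiveOperator H) : BorelSpace (WeakSpace B) := ⟨rfl⟩

/-- The identity `H → H`, with the second copy carrying the norm `‖·‖₋₁`. -/
def toPreWeak (B : StrictlyPositiveOperator H) (x : H) : PreWeak B := x

theorem norm_toPreWeak (B : StrictlyPositiveOperator H) (x : H) :
    ‖toPreWeak B x‖ = √(inner ℝ (B.op x) x) := rfl

theorem norm_toPreWeak_le (B : StrictlyPositiveOperator H) (x : H) :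
    ‖toPreWeak B x‖ ≤ √‖B.op‖ * ‖x‖ := by
  rw [norm_toPreWeak]
  refine Real.sqrt_le_iff.2 ⟨by positivity, ?_⟩
  rw [mul_pow, Real.sq_sqrt (norm_nonneg _)]
  calc inner ℝ (B.op x) x ≤ ‖B.op x‖ * ‖x‖ := real_inner_le_norm _ _
    _ ≤ ‖B.op‖ * ‖x‖ * ‖x‖ := by gcongr; exact B.op.le_opNorm x
    _ = ‖B.op‖ * ‖x‖ ^ 2 := by ring

/-- The canonical embedding `H → H₋₁`. -/
def toWeak (B : StrictlyPositiveOperator H) (x : H) : WeakSpace B := (toPreWeak B x : WeakSpace B)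

theorem norm_toWeak_le (B : StrictlyPositiveOperator H) (x : H) :
    ‖toWeak B x‖ ≤ √‖B.op‖ * ‖x‖ :=
  (UniformSpace.Completion.norm_coe (toPreWeak B x)).trans_le (norm_toPreWeak_le B x)

theorem continuous_toPreWeak (B : StrictlyPositiveOperator H) : Continuous (toPreWeak B) :=
  AddMonoidHomClass.continuous_of_bound
    (⟨⟨toPreWeak B, rfl⟩, fun _ _ => rfl⟩ : H →+ PreWeak B) (√‖B.op‖) (norm_toPreWeak_le B)

theorem continuous_toWeak (B : StrictlyPositiveOperator H) : Continuous (toWeak B) :=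
  (UniformSpace.Completion.continuous_coe _).comp (continuous_toPreWeak B)

instance [TopologicalSpace.SeparableSpace H] (B : StrictlyPositiveOperator H) :
    TopologicalSpace.SeparableSpace (PreWeak B) :=
  (Function.Surjective.denseRange (f := toPreWeak B) fun x => ⟨x, rfl⟩).separableSpace
    (continuous_toPreWeak B)

instance [TopologicalSpace.SeparableSpace H] (B : StrictlyPositiveOperator H) :
    SecondCountableTopology (WeakSpace B) :=
  UniformSpace.secondCountable_of_separable _

variable [MeasurableSpace H] [BorelSpace H]

/-- A measure `μ ∈ 𝒫_1(H)` regarded as an element of `𝒫_1(H₋₁)`, i.e. `F ↦ μ(F ∩ H)`. -/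
def PSpace.toWeak (B : StrictlyPositiveOperator H) (μ : PSpace 1 H) : PSpace 1 (WeakSpace B) where
  meas := μ.meas.map (HilbertFlow.toWeak B)
  isProb := Measure.isProbabilityMeasure_map (continuous_toWeak B).measurable.aemeasurable
  moment := by
    have hμ : ∫⁻ x, ‖x‖ₑ ∂μ.meas < ∞ := by simpa using μ.moment
    simp only [ENNReal.rpow_one]
    rw [lintegral_map measurable_enorm (continuous_toWeak B).measurable]
    have hle : ∀ x : H, ‖HilbertFlow.toWeak B x‖ₑ ≤ ENNReal.ofReal (√‖B.op‖) * ‖x‖ₑ := by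
      intro x
      rw [← ofReal_norm, ← ofReal_norm, ← ENNReal.ofReal_mul (Real.sqrt_nonneg _)]
      exact ENNReal.ofReal_le_ofReal (norm_toWeak_le B x)
    refine (lintegral_mono hle).trans_lt ?_
    rw [lintegral_const_mul _ measurable_enorm]
    exact ENNReal.mul_lt_top ENNReal.ofReal_lt_top hμ

/-! ### The sets of measures and flows -/

/-- `Q`: the measures in `𝒫_1(H)` with `∫ ‖x‖² dμ ≤ c`. -/
def momentBall (H : Type*) [NormedAddCommGroup H] [MeasurableSpace H] (c : ℝ≥0) :
    Set (PSpace 1 H) :=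
  {μ | ∫⁻ x, ‖x‖ₑ ^ 2 ∂μ.meas ≤ c}

/-- The set of all `m : [0,T] → Q` with `m(0) = m₀` and
`d_{1,-1}(m(t), m(s)) ≤ M √|t - s|` for all `s, t ∈ [0,T]`. -/
def holderFlows [TopologicalSpace.SeparableSpace H] (B : StrictlyPositiveOperator H) {T : ℝ}
    (hT : 0 < T) (m₀ : PSpace 2 H) (c M : ℝ≥0) : Set (Icc 0 T → PSpace 1 H) :=
  {m | (∀ t, m t ∈ momentBall H c) ∧ (m ⟨0, left_mem_Icc.2 hT.le⟩).meas = m₀.meas ∧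
    ∀ s t : Icc 0 T,
      dist ((m t).toWeak B) ((m s).toWeak B) ≤ M * √|(t : ℝ) - (s : ℝ)|}

/-- The same set, viewed inside `C([0,T]; (𝒫_1(H₋₁), d_{1,-1}))` with its uniform metric. -/
def holderFlowsInC [TopologicalSpace.SeparableSpace H] (B : StrictlyPositiveOperator H) {T : ℝ}
    (hT : 0 < T) (m₀ : PSpace 2 H) (c M : ℝ≥0) : Set C(Icc 0 T, PSpace 1 (WeakSpace B)) :=
  {f | ∃ m ∈ holderFlows B hT m₀ c M, ∀ t, f t = (m t).toWeak B}

/-- A flow of measures as a function with values in the vector space of finite signed measures;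
convexity of a set of flows refers to the linear structure of this space. -/
def toSignedFlow {I X : Type*} [TopologicalSpace I] [NormedAddCommGroup X] [MeasurableSpace X]
    [TopologicalSpace (PSpace 1 X)] (f : C(I, PSpace 1 X)) : I → SignedMeasure X :=
  fun t => (f t).meas.toSignedMeasure

end HilbertFlow

end

open HilbertFlow

/-! The heart of the matter is that the image of $Q$ in $\mathcal P_1(H_{-1})$ is compact. Since
$\|x\|_{-1}^2\le\|Bx\|\,\|x\|$ and $B$ is compact, balls of $H$ become compact in $H_{-1}$. The
second moment bound then makes the image tight, with first moments uniformly small off compact sets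
(`exists_isCompact_forall_tail_le`), and Prokhorov's theorem applies.

The image is also weakly closed. The second moment of $\mu$ can be read off its image $\nu$ as
$\int_0^\infty\nu(H_{-1}\setminus\bar B_{\sqrt t})\,dt$, with $\bar B_r$ the ball of $H$. This is
lower semicontinuous in $\nu$, and when finite it forces $\nu$ to be carried by $H$
(`exists_momentBall_map_iff`). Finally, weak convergence with uniformly small tails is Wasserstein
convergence (`tendsto_transportCost_of_tendsto`).

The Hölder bound gives continuity and equicontinuity and survives pointwise limits, so Arzelà–Ascoli
yields compactness of the set of flows. Convexity holds because mixtures of couplings are couplings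
of mixtures. -/

namespace HilbertFlow

/-! ### Transport cost: mixtures, quantization, weak convergence -/

section TransportCost

variable {X : Type*} [NormedAddCommGroup X] [MeasurableSpace X]

theorem transportCost_add_smul_le (a b : ℝ≥0) {μ μ' ν ν' : Measure X}
    (h : (couplings μ ν).Nonempty) (h' : (couplings μ' ν').Nonempty) :
    transportCost (a • μ + b • μ') (a • ν + b • ν') ≤
      a * transportCost μ ν + b * transportCost μ' ν' := by
  have key : ∀ γ ∈ couplings μ ν, ∀ γ' ∈ couplings μ' ν',
      transportCost (a • μ + b • μ') (a • ν + b • ν') ≤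
        a * ∫⁻ z, ‖z.1 - z.2‖ₑ ∂γ + b * ∫⁻ z, ‖z.1 - z.2‖ₑ ∂γ' := by
    intro γ hγ γ' hγ'
    have hmem : a • γ + b • γ' ∈ couplings (a • μ + b • μ') (a • ν + b • ν') := by
      constructor
      · rw [Measure.map_add _ _ measurable_fst, Measure.map_smul, Measure.map_smul, hγ.1, hγ'.1]
      · rw [Measure.map_add _ _ measurable_snd, Measure.map_smul, Measure.map_smul, hγ.2, hγ'.2]
    refine (transportCost_le hmem).trans ?_
    rw [lintegral_add_measure, lintegral_smul_measure, lintegral_smul_measure]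
    exact le_rfl
  unfold transportCost at key ⊢
  have := h.to_subtype
  have := h'.to_subtype
  simp only [iInf_subtype' (p := (· ∈ couplings μ ν)), iInf_subtype' (p := (· ∈ couplings μ' ν'))]
  -- Nonemptiness matters when a coefficient is $0$: an infimum over no couplings is $\infty$, while
  -- $0\cdot\infty=0$.
  rw [ENNReal.mul_iInf' (by simp) fun _ => inferInstance,
    ENNReal.mul_iInf' (by simp) fun _ => inferInstance]
  simp only [ENNReal.iInf_add, ENNReal.add_iInf]
  exact le_iInf fun γ' => le_iInf fun γ => key γ γ.2 γ' γ'.2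

variable [BorelSpace X]

/-- Around each point some radius in $(0,\varepsilon)$ gives a ball with null frontier. Finitely
many such balls cover `C`, and making them disjoint keeps frontiers null. The null frontiers let
cell masses pass to weak limits. -/
theorem exists_partition_null_frontier (μ : Measure X) [SFinite μ] {C : Set X} (hC : IsCompact C)
    {ε : ℝ} (hε : 0 < ε) :
    ∃ (n : ℕ) (A : Fin n → Set X) (y : Fin n → X), (∀ i, MeasurableSet (A i)) ∧
      Pairwise (Function.onFun Disjoint A) ∧ ⋃ i, A i = univ ∧ (∀ i, μ (frontier (A i)) = 0) ∧
      ∀ i, A i ⊆ Metric.ball (y i) ε ∨ y i = 0 ∧ A i ⊆ Cᶜ := by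
  choose r hr hr0 using fun x : X => exists_null_frontier_thickening μ {x} hε
  simp_rw [Metric.thickening_singleton] at hr0
  obtain ⟨t, -, ht⟩ := hC.elim_nhds_subcover (fun x => Metric.ball x (r x))
    fun x _ => Metric.ball_mem_nhds x (hr x).1
  set x : Fin t.card → X := fun i => (t.equivFin.symm i : X) with hx
  -- Appending `univ` last makes the final disjointed cell the remainder, which misses `C`; its
  -- representative is the origin.
  set U : Fin (t.card + 1) → Set X :=
    Fin.snoc (α := fun _ => Set X) (fun i => Metric.ball (x i) (r (x i))) univ with hU
  have hUc : ∀ i : Fin t.card, U i.castSucc = Metric.ball (x i) (r (x i)) := fun i => by simp [hU]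
  have hUl : U (Fin.last _) = univ := by simp [hU]
  have hUm : ∀ i, MeasurableSet (U i) := by
    refine Fin.lastCases ?_ fun i => ?_
    · rw [hUl]; exact MeasurableSet.univ
    · rw [hUc]; exact measurableSet_ball
  have hUf : ∀ i, μ (frontier (U i)) = 0 := by
    refine Fin.lastCases ?_ fun i => ?_
    · rw [hUl]; simp
    · rw [hUc]; exact hr0 _
  refine ⟨t.card + 1, disjointed U, Fin.snoc (α := fun _ => X) x 0,
    fun i => disjointedRec (fun s j hs => hs.diff (hUm j)) (hUm i), disjoint_disjointed U,
    ?_, fun i => disjointedRec (p := fun s => μ (frontier s) = 0) (fun s j hs => ?_) (hUf i), ?_⟩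
  · rw [iUnion_disjointed, eq_univ_iff_forall]
    exact fun z => mem_iUnion.2 ⟨Fin.last _, hUl ▸ mem_univ z⟩
  · exact null_frontier_inter hs ((frontier_compl (U j)).symm ▸ hUf j)
  · refine Fin.lastCases (Or.inr ⟨by simp, fun z hz hzC => ?_⟩) fun i => Or.inl ?_
    · obtain ⟨p, hp, hzp⟩ := mem_iUnion₂.1 (ht hzC)
      rw [disjointed_eq_inter_compl] at hz
      refine mem_iInter₂.1 hz.2 _ (Fin.castSucc_lt_last (t.equivFin ⟨p, hp⟩)) ?_
      rw [hUc]
      simpa [hx] using hzp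
    · refine (disjointed_subset U _).trans ?_
      rw [hUc, Fin.snoc_castSucc]
      exact Metric.ball_subset_ball (hr _).2.le

variable [SecondCountableTopology X]

/-- Mass common to two measures need not be moved. -/
theorem transportCost_add_le_of_measure_univ_eq {ρ α β : Measure X} [SFinite ρ]
    [IsFiniteMeasure α] [IsFiniteMeasure β] (h : α univ = β univ) :
    transportCost (ρ + α) (ρ + β) ≤ ∫⁻ x, ‖x‖ₑ ∂α + ∫⁻ x, ‖x‖ₑ ∂β := by
  have hd : Measurable (fun x : X => (x, x)) := measurable_id.prodMk measurable_id
  have hfin : β univ ≠ ∞ := measure_ne_top β univ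
  rcases eq_or_ne (β univ) 0 with h0 | h0
  · rw [Measure.measure_univ_eq_zero.1 (h.trans h0), Measure.measure_univ_eq_zero.1 h0,
      transportCost_self]
    exact bot_le
  -- The common part stays on the diagonal at no cost; the excesses are coupled by their normalized
  -- product.
  have hmem : ρ.map (fun x => (x, x)) + (β univ)⁻¹ • α.prod β ∈ couplings (ρ + α) (ρ + β) := by
    constructor
    · rw [Measure.map_add _ _ measurable_fst, Measure.map_map measurable_fst hd,
        Measure.map_smul, Measure.map_fst_prod, smul_smul, ENNReal.inv_mul_cancel h0 hfin,
        one_smul]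
      exact congrArg (· + α) Measure.map_id
    · rw [Measure.map_add _ _ measurable_snd, Measure.map_map measurable_snd hd,
        Measure.map_smul, Measure.map_snd_prod, h, smul_smul, ENNReal.inv_mul_cancel h0 hfin,
        one_smul]
      exact congrArg (· + β) Measure.map_id
  refine (transportCost_le hmem).trans ?_
  rw [lintegral_add_measure, lintegral_map measurable_cost hd, lintegral_smul_measure]
  have h1 : ∫⁻ z, ‖z.1‖ₑ ∂(α.prod β) = β univ * ∫⁻ x, ‖x‖ₑ ∂α := by
    rw [← lintegral_map measurable_enorm measurable_fst, Measure.map_fst_prod,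
      lintegral_smul_measure, smul_eq_mul]
  have h2 : ∫⁻ z, ‖z.2‖ₑ ∂(α.prod β) = β univ * ∫⁻ x, ‖x‖ₑ ∂β := by
    rw [← lintegral_map measurable_enorm measurable_snd, Measure.map_snd_prod,
      lintegral_smul_measure, smul_eq_mul, h]
  have hle : ∫⁻ z, ‖z.1 - z.2‖ₑ ∂(α.prod β) ≤
      β univ * (∫⁻ x, ‖x‖ₑ ∂α + ∫⁻ x, ‖x‖ₑ ∂β) := by
    rw [mul_add, ← h1, ← h2, ← lintegral_add_left measurable_fst.enorm]
    exact lintegral_mono fun z => enorm_sub_le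
  simp only [sub_self, enorm_zero, lintegral_zero, zero_add, smul_eq_mul]
  calc (β univ)⁻¹ * ∫⁻ z, ‖z.1 - z.2‖ₑ ∂(α.prod β)
      ≤ (β univ)⁻¹ * (β univ * (∫⁻ x, ‖x‖ₑ ∂α + ∫⁻ x, ‖x‖ₑ ∂β)) := by gcongr
    _ = ∫⁻ x, ‖x‖ₑ ∂α + ∫⁻ x, ‖x‖ₑ ∂β := by
      rw [← mul_assoc, ENNReal.inv_mul_cancel h0 hfin, one_mul]

/-- The common part $\min(w_i,w_i')$ stays put; the truncated differences have equal total mass and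
are moved at a cost bounded by their first moments. The bound vanishes as the weights converge. -/
theorem transportCost_sum_dirac_le {ι : Type*} [Fintype ι] (y : ι → X) {w w' : ι → ℝ≥0∞}
    (hw : ∀ i, w i ≠ ∞) (hw' : ∀ i, w' i ≠ ∞) (h : ∑ i, w i = ∑ i, w' i) :
    transportCost (∑ i, w i • Measure.dirac (y i)) (∑ i, w' i • Measure.dirac (y i)) ≤
      ∑ i, ((w i - w' i) + (w' i - w i)) * ‖y i‖ₑ := by
  have hfin : ∀ v : ι → ℝ≥0∞, (∀ i, v i ≠ ∞) →
      IsFiniteMeasure (∑ i, v i • Measure.dirac (y i)) := by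
    intro v hv
    refine ⟨?_⟩
    simpa [Measure.finsetSum_apply, ENNReal.sum_lt_top, lt_top_iff_ne_top] using hv
  have hsplit : ∀ v v' : ι → ℝ≥0∞, ∑ i, v i • Measure.dirac (y i) =
      ∑ i, min (v i) (v' i) • Measure.dirac (y i) + ∑ i, (v i - v' i) • Measure.dirac (y i) := by
    intro v v'
    rw [← Finset.sum_add_distrib]
    refine Finset.sum_congr rfl fun i _ => ?_
    rw [← add_smul, add_comm, tsub_add_min]
  have hint : ∀ v : ι → ℝ≥0∞, ∫⁻ x, ‖x‖ₑ ∂(∑ i, v i • Measure.dirac (y i)) =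
      ∑ i, v i * ‖y i‖ₑ := by
    intro v
    simp [lintegral_dirac]
  have := hfin (fun i => min (w i) (w' i)) fun i => by simp [hw i]
  have := hfin (fun i => w i - w' i) fun i => ENNReal.sub_ne_top (hw i)
  have := hfin (fun i => w' i - w i) fun i => ENNReal.sub_ne_top (hw' i)
  have hmass : ∑ i, (w i - w' i) = ∑ i, (w' i - w i) := by
    have hm : ∑ i, min (w i) (w' i) ≠ ∞ := by
      rw [ENNReal.sum_ne_top]
      exact fun i _ => by simp [hw i]
    refine (ENNReal.add_left_inj hm).1 ?_
    rw [← Finset.sum_add_distrib, ← Finset.sum_add_distrib]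
    simp_rw [tsub_add_min, min_comm (w _) (w' _), tsub_add_min]
    exact h
  rw [hsplit w w', hsplit w' w]
  simp_rw [min_comm (w' _) (w _)]
  refine (transportCost_add_le_of_measure_univ_eq ?_).trans ?_
  · simpa [Measure.finsetSum_apply] using hmass
  · rw [hint, hint, ← Finset.sum_add_distrib]
    simp_rw [add_mul]
    exact le_rfl

/-- The cost of moving each cell of a finite partition to a point. -/
theorem transportCost_sum_dirac_partition_le {ι : Type*} [Fintype ι] (μ : Measure X)
    {A : ι → Set X} (y : ι → X) (hA : ∀ i, MeasurableSet (A i))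
    (hd : Pairwise (Function.onFun Disjoint A)) (hU : ⋃ i, A i = univ) :
    transportCost μ (∑ i, μ (A i) • Measure.dirac (y i)) ≤
      ∑ i, ∫⁻ x in A i, ‖x - y i‖ₑ ∂μ := by
  have hm : ∀ i, Measurable (fun x : X => (x, y i)) := fun i =>
    measurable_id.prodMk measurable_const
  have hmem : ∑ i, (μ.restrict (A i)).map (fun x => (x, y i)) ∈
      couplings μ (∑ i, μ (A i) • Measure.dirac (y i)) := by
    constructor
    · rw [Measure.map_finset_sum measurable_fst.aemeasurable]
      simp_rw [Measure.map_map measurable_fst (hm _)]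
      have : ∀ i, (μ.restrict (A i)).map (Prod.fst ∘ fun x => (x, y i)) = μ.restrict (A i) :=
        fun i => Measure.map_id
      simp_rw [this]
      rw [← Measure.sum_fintype, ← Measure.restrict_iUnion hd hA, hU, Measure.restrict_univ]
    · rw [Measure.map_finset_sum measurable_snd.aemeasurable]
      simp_rw [Measure.map_map measurable_snd (hm _)]
      have : ∀ i, (μ.restrict (A i)).map (Prod.snd ∘ fun x => (x, y i)) =
          μ (A i) • Measure.dirac (y i) := by
        intro i
        have h1 : (Prod.snd ∘ fun x : X => (x, y i)) = fun _ => y i := rfl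
        rw [h1, Measure.map_const, Measure.restrict_apply_univ]
      simp_rw [this]
  refine (transportCost_le hmem).trans ?_
  rw [lintegral_finsetSum_measure]
  simp_rw [lintegral_map measurable_cost (hm _)]
  exact le_rfl

theorem transportCost_quantization_le (μ : Measure X) [IsProbabilityMeasure μ] {n : ℕ}
    {A : Fin n → Set X} {y : Fin n → X} {C : Set X} {ε : ℝ≥0}
    (hA : ∀ i, MeasurableSet (A i)) (hC : MeasurableSet C)
    (hd : Pairwise (Function.onFun Disjoint A)) (hU : ⋃ i, A i = univ)
    (h : ∀ i, A i ⊆ Metric.ball (y i) ε ∨ y i = 0 ∧ A i ⊆ Cᶜ) :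
    transportCost μ (∑ i, μ (A i) • Measure.dirac (y i)) ≤ ε + ∫⁻ x in Cᶜ, ‖x‖ₑ ∂μ := by
  refine (transportCost_sum_dirac_partition_le μ y hA hd hU).trans ?_
  -- A single function dominating the cost on every cell, so that the cell integrals reassemble into
  -- one.
  set g : X → ℝ≥0∞ := fun x => ε + Cᶜ.indicator (fun x => ‖x‖ₑ) x with hg
  have hle : ∀ i, ∫⁻ x in A i, ‖x - y i‖ₑ ∂μ ≤ ∫⁻ x in A i, g x ∂μ := by
    intro i
    refine setLIntegral_mono' (hA i) fun x hx => ?_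
    rcases h i with h | ⟨hy, hs⟩
    · refine le_add_right ?_
      have := Metric.mem_ball.1 (h hx)
      rw [dist_eq_norm] at this
      rw [enorm_eq_nnnorm]
      exact_mod_cast this.le
    · rw [hy, sub_zero, hg]
      simp only [indicator_of_mem (hs hx)]
      exact le_add_self
  calc ∑ i, ∫⁻ x in A i, ‖x - y i‖ₑ ∂μ ≤ ∑ i, ∫⁻ x in A i, g x ∂μ :=
        Finset.sum_le_sum fun i _ => hle i
    _ = ∫⁻ x, g x ∂μ := by
        rw [← tsum_fintype (L := .unconditional _), ← lintegral_iUnion hA hd, hU, setLIntegral_univ]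
    _ = ε + ∫⁻ x in Cᶜ, ‖x‖ₑ ∂μ := by
        rw [hg, lintegral_add_left measurable_const, lintegral_indicator hC.compl]
        simp

/-- Weak convergence of measures with uniformly small first moments off compact sets is
convergence for the Wasserstein distance. -/
theorem tendsto_transportCost_of_tendsto [CompleteSpace X] {I : Type*} {L : Filter I}
    {μs : I → ProbabilityMeasure X} {μ : ProbabilityMeasure X} (hlim : Tendsto μs L (𝓝 μ))
    (htail : ∀ ε : ℝ≥0∞, 0 < ε → ∃ C : Set X, IsCompact C ∧ ∫⁻ x in Cᶜ, ‖x‖ₑ ∂(μ : Measure X) ≤ ε ∧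
      ∀ i, ∫⁻ x in Cᶜ, ‖x‖ₑ ∂(μs i : Measure X) ≤ ε) :
    Tendsto (fun i => transportCost (μs i : Measure X) μ) L (𝓝 0) := by
  rw [ENNReal.tendsto_nhds_zero]
  intro ε hε
  obtain ⟨δ, hδ0, hδ⟩ := ENNReal.lt_iff_exists_nnreal_btwn.1 hε
  have hδ0 : 0 < δ := by exact_mod_cast hδ0
  -- Each of the two quantizations costs $2\eta$ (cell size and tail), and passing between the
  -- discrete measures costs $\eta$.
  set η : ℝ≥0 := δ / 5 with hη
  have hη0 : 0 < η := by positivity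
  obtain ⟨C, hC, hCμ, hCs⟩ := htail η (by exact_mod_cast hη0)
  obtain ⟨n, A, y, hA, hd, hU, hf, h⟩ := exists_partition_null_frontier (μ : Measure X) hC hη0
  set w : I → Fin n → ℝ≥0∞ := fun k i => (μs k : Measure X) (A i) with hw
  set w' : Fin n → ℝ≥0∞ := fun i => (μ : Measure X) (A i) with hw'
  have hmass : ∀ ν : Measure X, [IsProbabilityMeasure ν] → ∑ i, ν (A i) = 1 := by
    intro ν _
    rw [← tsum_fintype (L := .unconditional _), ← measure_iUnion hd hA, hU, measure_univ]
  have hsum : Tendsto (fun k => ∑ i, ((w k i - w' i) + (w' i - w k i)) * ‖y i‖ₑ) L (𝓝 0) := by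
    have h0 : ∑ i, ((w' i - w' i) + (w' i - w' i)) * ‖y i‖ₑ = 0 := by simp
    rw [← h0]
    refine tendsto_finsetSum _ fun i _ => ?_
    have hi : Tendsto (fun k => w k i) L (𝓝 (w' i)) :=
      ProbabilityMeasure.tendsto_measure_of_null_frontier_of_tendsto' hlim (hf i)
    have hi' : w' i ≠ ∞ := measure_ne_top _ _
    refine ENNReal.Tendsto.mul_const (Tendsto.add ?_ ?_) (Or.inr enorm_ne_top)
    · exact ENNReal.Tendsto.sub hi tendsto_const_nhds (Or.inl hi')
    · exact ENNReal.Tendsto.sub tendsto_const_nhds hi (Or.inl hi')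
  filter_upwards [(ENNReal.tendsto_nhds_zero.1 hsum) η (by exact_mod_cast hη0)] with k hk
  have hq : IsProbabilityMeasure (∑ i, w k i • Measure.dirac (y i)) := by
    refine ⟨?_⟩
    simpa [Measure.finsetSum_apply] using hmass (μs k)
  have h1 : transportCost (μs k : Measure X) (∑ i, w k i • Measure.dirac (y i)) ≤ η + η :=
    (transportCost_quantization_le _ hA hC.measurableSet hd hU h).trans (by gcongr; exact hCs k)
  have h2 : transportCost (∑ i, w k i • Measure.dirac (y i)) (∑ i, w' i • Measure.dirac (y i)) ≤ η :=
    (transportCost_sum_dirac_le y (fun i => measure_ne_top _ _) (fun i => measure_ne_top _ _)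
      ((hmass (μs k)).trans (hmass μ).symm)).trans hk
  have h3 : transportCost (∑ i, w' i • Measure.dirac (y i)) (μ : Measure X) ≤ η + η :=
    (transportCost_comm_le _ _).trans
      ((transportCost_quantization_le _ hA hC.measurableSet hd hU h).trans (by gcongr))
  calc transportCost (μs k : Measure X) μ
      ≤ transportCost (μs k : Measure X) (∑ i, w k i • Measure.dirac (y i)) +
        (transportCost (∑ i, w k i • Measure.dirac (y i)) (∑ i, w' i • Measure.dirac (y i)) +
          transportCost (∑ i, w' i • Measure.dirac (y i)) μ) :=
        (transportCost_triangle _ _ _).trans (by gcongr; exact transportCost_triangle _ _ _)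
    _ ≤ (η + η) + (η + (η + η)) := by gcongr
    _ = δ := by
        have : (η + η) + (η + (η + η)) = δ := by rw [hη]; field_simp; norm_num
        exact_mod_cast this
    _ ≤ ε := hδ.le

end TransportCost

/-! ### Tails under a second moment bound -/

section Moments

variable {E : Type*} [NormedAddCommGroup E] [MeasurableSpace E]

theorem PSpace.moment_one_lt_top_of_sq {μ : Measure E} [IsProbabilityMeasure μ]
    (h : ∫⁻ x, ‖x‖ₑ ^ 2 ∂μ < ∞) : ∫⁻ x, ‖x‖ₑ ^ (1 : ℝ) ∂μ < ∞ := by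
  have hle : ∀ x : E, ‖x‖ₑ ^ (1 : ℝ) ≤ 1 + ‖x‖ₑ ^ 2 := by
    intro x
    rw [ENNReal.rpow_one]
    rcases le_total ‖x‖ₑ 1 with hx | hx
    · exact hx.trans le_self_add
    · exact (le_self_pow₀ hx two_ne_zero).trans le_add_self
  refine (lintegral_mono hle).trans_lt ?_
  rw [lintegral_add_left measurable_const]
  simpa using h

variable [BorelSpace E]

/-- Off the ball, $R\|x\|\le\|x\|^2$. -/
theorem mul_lintegral_compl_closedBall_le {c : ℝ≥0} {μ : PSpace 1 E} (hμ : μ ∈ momentBall E c)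
    (R : ℝ≥0) : R * ∫⁻ x in (Metric.closedBall 0 R)ᶜ, ‖x‖ₑ ∂μ.meas ≤ c := by
  rw [← lintegral_const_mul _ measurable_enorm]
  refine le_trans ?_ ((setLIntegral_le_lintegral (Metric.closedBall 0 R)ᶜ _).trans hμ)
  refine setLIntegral_mono' Metric.isClosed_closedBall.measurableSet.compl fun x hx => ?_
  rw [sq]
  gcongr
  rw [mem_compl_iff, mem_closedBall_zero_iff, not_le] at hx
  rw [enorm_eq_nnnorm]
  exact_mod_cast hx.le

theorem exists_forall_lintegral_compl_closedBall_le (c : ℝ≥0) {ε : ℝ≥0∞} (hε : 0 < ε) :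
    ∃ R : ℝ≥0, 1 ≤ R ∧ ∀ μ ∈ momentBall E c,
      ∫⁻ x in (Metric.closedBall 0 R)ᶜ, ‖x‖ₑ ∂μ.meas ≤ ε := by
  obtain ⟨δ, hδ0, hδ⟩ := ENNReal.lt_iff_exists_nnreal_btwn.1 hε
  have hδ0 : 0 < δ := by exact_mod_cast hδ0
  -- The summand $1$ makes the radius cancellable and at least $1$, so that the tail of the first
  -- moment also dominates the tail mass.
  refine ⟨c / δ + 1, le_add_self, fun μ hμ => le_trans ?_ hδ.le⟩
  have h := mul_lintegral_compl_closedBall_le hμ (c / δ + 1)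
  have h2 : (c : ℝ≥0∞) ≤ ((c / δ + 1 : ℝ≥0) : ℝ≥0∞) * δ := by
    have : c ≤ (c / δ + 1) * δ := by
      rw [add_mul, div_mul_cancel₀ _ hδ0.ne']
      exact le_self_add
    exact_mod_cast this
  exact (ENNReal.mul_le_mul_iff_right (by simp) ENNReal.coe_ne_top).1 (h.trans h2)

end Moments

/-! ### Images of moment balls under an injective operator -/

section Embedding

variable {E X : Type*} [NormedAddCommGroup E] [InnerProductSpace ℝ E] [CompleteSpace E]
  [NormedAddCommGroup X] [InnerProductSpace ℝ X] [CompleteSpace X]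

/-- The image of a closed ball under a bounded operator between Hilbert spaces is closed. -/
theorem isClosed_image_closedBall (ι : E →L[ℝ] X) (R : ℝ) :
    IsClosed (ι '' Metric.closedBall 0 R) := by
  set K : Set (WeakDual ℝ E) := WeakDual.toStrongDual ⁻¹' Metric.closedBall 0 R with hK
  have hKc : CompactSpace K := isCompact_iff_compactSpace.1 (WeakDual.isCompact_closedBall 0 R)
  -- The graph of `ι` over the ball, written through the adjoint so that it is closed when the ball
  -- carries its weak-* compact topology; projecting along a compact factor is a closed map.
  set Z : Set (X × K) := {p | ∀ w, inner ℝ p.1 w = p.2.1 (ι.adjoint w)} with hZ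
  have hZc : IsClosed Z := by
    simp only [hZ, ofPred_forall]
    refine isClosed_iInter fun w => isClosed_eq (by fun_prop) ?_
    exact (WeakDual.eval_continuous (ι.adjoint w)).comp (continuous_subtype_val.comp continuous_snd)
  have heq : ι '' Metric.closedBall 0 R = Prod.fst '' Z := by
    ext y
    constructor
    · rintro ⟨x, hx, rfl⟩
      refine ⟨(ι x, ⟨StrongDual.toWeakDual (InnerProductSpace.toDual ℝ E x), ?_⟩), fun w => ?_, rfl⟩
      · simpa [hK] using hx
      · exact (ContinuousLinearMap.adjoint_inner_right ι x w).symm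
    · rintro ⟨⟨y, φ, hφ⟩, h, rfl⟩
      refine ⟨(InnerProductSpace.toDual ℝ E).symm (WeakDual.toStrongDual φ), ?_, ?_⟩
      · simpa [hK] using hφ
      · refine ext_inner_right ℝ fun w => ?_
        rw [← ContinuousLinearMap.adjoint_inner_right, InnerProductSpace.toDual_symm_apply]
        exact (h w).symm
  rw [heq]
  exact isClosedMap_fst_of_compactSpace _ hZc

variable [MeasurableSpace X] [BorelSpace X]

/-- The complements of the balls' images are open, so portmanteau and Fatou make the integral lower
semicontinuous. -/
theorem isClosed_setOf_lintegral_measure_compl_le [SecondCountableTopology X] (ι : E →L[ℝ] X)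
    (c : ℝ≥0) : IsClosed {ν : ProbabilityMeasure X |
      ∫⁻ t in Ioi (0 : ℝ), (ν : Measure X) (ι '' Metric.closedBall 0 √t)ᶜ ≤ c} := by
  refine IsSeqClosed.isClosed fun νs ν hνs hν => ?_
  have hmeas : ∀ ν : ProbabilityMeasure X,
      Measurable fun t : ℝ => (ν : Measure X) (ι '' Metric.closedBall 0 √t)ᶜ := by
    intro ν
    refine Antitone.measurable fun s t hst => measure_mono (compl_subset_compl.2 (image_mono ?_))
    exact Metric.closedBall_subset_closedBall (Real.sqrt_le_sqrt hst)
  calc ∫⁻ t in Ioi (0 : ℝ), (ν : Measure X) (ι '' Metric.closedBall 0 √t)ᶜ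
      ≤ ∫⁻ t in Ioi (0 : ℝ),
          liminf (fun n => (νs n : Measure X) (ι '' Metric.closedBall 0 √t)ᶜ) atTop :=
        lintegral_mono fun t => ProbabilityMeasure.le_liminf_measure_open_of_tendsto hν
          (isClosed_image_closedBall ι _).isOpen_compl
    _ ≤ liminf (fun n => ∫⁻ t in Ioi (0 : ℝ),
          (νs n : Measure X) (ι '' Metric.closedBall 0 √t)ᶜ) atTop :=
        lintegral_liminf_le fun n => hmeas (νs n)
    _ ≤ c := liminf_le_of_le (by isBoundedDefault) fun b hb => by
        obtain ⟨n, hn⟩ := hb.exists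
        exact hn.trans (hνs n)

variable [MeasurableSpace E] [BorelSpace E]

/-- Layer-cake formula for the second moment of a measure, in terms of its image under an injective
map. -/
theorem lintegral_measure_compl_image_closedBall {ι : E →L[ℝ] X} (hι : Function.Injective ι)
    (μ : Measure E) :
    ∫⁻ t in Ioi (0 : ℝ), (μ.map ι) (ι '' Metric.closedBall 0 √t)ᶜ = ∫⁻ x, ‖x‖ₑ ^ 2 ∂μ := by
  have h1 : ∀ x : E, ‖x‖ₑ ^ 2 = ENNReal.ofReal (‖x‖ ^ 2) := fun x => by
    rw [ENNReal.ofReal_pow (norm_nonneg _), ofReal_norm]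
  simp_rw [h1]
  rw [lintegral_eq_lintegral_meas_lt μ (Eventually.of_forall fun x => sq_nonneg _)
    (by fun_prop)]
  refine setLIntegral_congr_fun measurableSet_Ioi fun t ht => ?_
  rw [Measure.map_apply ι.continuous.measurable
    (isClosed_image_closedBall ι _).measurableSet.compl, preimage_compl, hι.preimage_image]
  congr 1
  ext x
  rw [mem_compl_iff, mem_closedBall_zero_iff, not_le, mem_ofPred_eq,
    Real.sqrt_lt (mem_Ioi.1 ht).le (norm_nonneg x)]

/-- Describes the image of the moment ball by `ν` alone. The integrand is at least the mass outside
`range ι`, so a finite integral over a half-line forces that mass to vanish; as `ι` is a measurable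
embedding, `ν` can then be pulled back. -/
theorem exists_momentBall_map_iff [SecondCountableTopology E] {ι : E →L[ℝ] X}
    (hι : Function.Injective ι) (c : ℝ≥0) (ν : Measure X) [IsProbabilityMeasure ν] :
    (∃ μ ∈ momentBall E c, ν = μ.meas.map ι) ↔
      ∫⁻ t in Ioi (0 : ℝ), ν (ι '' Metric.closedBall 0 √t)ᶜ ≤ c := by
  constructor
  · rintro ⟨μ, hμ, rfl⟩
    rw [lintegral_measure_compl_image_closedBall hι]
    exact hμ
  · intro h
    have hemb : MeasurableEmbedding ι := ι.continuous.measurableEmbedding hι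
    have hrange : ν (range ι)ᶜ = 0 := by
      by_contra h0
      have : ∫⁻ t in Ioi (0 : ℝ), ν (range ι)ᶜ ≤ c := by
        refine le_trans (lintegral_mono fun t => measure_mono ?_) h
        exact compl_subset_compl.2 (image_subset_range _ _)
      rw [setLIntegral_const, Real.volume_Ioi, ENNReal.mul_top h0] at this
      simp at this
    have hmap : (ν.comap ι).map ι = ν := by
      rw [hemb.map_comap]
      exact Measure.restrict_eq_self_of_ae_mem (mem_ae_iff.2 hrange)
    have hprob : IsProbabilityMeasure (ν.comap ι) := by
      refine ⟨?_⟩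
      have := measure_univ (μ := ν)
      rwa [← hmap, Measure.map_apply ι.continuous.measurable MeasurableSet.univ,
        preimage_univ] at this
    have hmom : ∫⁻ x, ‖x‖ₑ ^ 2 ∂(ν.comap ι) ≤ c := by
      rwa [← lintegral_measure_compl_image_closedBall hι, hmap]
    exact ⟨⟨ν.comap ι, hprob, PSpace.moment_one_lt_top_of_sq
      (hmom.trans_lt ENNReal.coe_lt_top)⟩, hmom, hmap.symm⟩

theorem exists_isCompact_forall_tail_le {ι : E →L[ℝ] X} (hι : Function.Injective ι)
    (hcomp : ∀ R, IsCompact (ι '' Metric.closedBall 0 R)) (c : ℝ≥0) {ε : ℝ≥0∞} (hε : 0 < ε) :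
    ∃ C : Set X, IsCompact C ∧ ∀ μ ∈ momentBall E c,
      (μ.meas.map ι) Cᶜ ≤ ε ∧ ∫⁻ x in Cᶜ, ‖x‖ₑ ∂(μ.meas.map ι) ≤ ε := by
  -- Absorbs the factor in $\|\iota x\|\le\|\iota\|\,\|x\|$; the $1$ covers $\iota=0$.
  have hδ : 0 < ε / (‖ι‖ₑ + 1) := ENNReal.div_pos hε.ne' (by simp)
  obtain ⟨R, hR, h⟩ := exists_forall_lintegral_compl_closedBall_le (E := E) c (lt_min hε hδ)
  refine ⟨ι '' Metric.closedBall 0 R, hcomp R, fun μ hμ => ?_⟩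
  have hm : MeasurableSet (ι '' Metric.closedBall 0 R)ᶜ :=
    (isClosed_image_closedBall ι _).measurableSet.compl
  have hb : MeasurableSet (Metric.closedBall (0 : E) R)ᶜ :=
    Metric.isClosed_closedBall.measurableSet.compl
  have hpre : ι ⁻¹' (ι '' Metric.closedBall 0 R)ᶜ = (Metric.closedBall 0 R)ᶜ := by
    rw [preimage_compl, hι.preimage_image]
  constructor
  · rw [Measure.map_apply ι.continuous.measurable hm, hpre, ← setLIntegral_one]
    refine le_trans (setLIntegral_mono' hb fun x hx => ?_) ((h μ hμ).trans (min_le_left _ _))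
    rw [mem_compl_iff, mem_closedBall_zero_iff, not_le] at hx
    have hR' : (1 : ℝ) ≤ R := by exact_mod_cast hR
    rw [enorm_eq_nnnorm]
    exact_mod_cast hR'.trans hx.le
  · rw [setLIntegral_map hm measurable_enorm ι.continuous.measurable, hpre]
    calc ∫⁻ x in (Metric.closedBall 0 R)ᶜ, ‖ι x‖ₑ ∂μ.meas
        ≤ ∫⁻ x in (Metric.closedBall 0 R)ᶜ, ‖ι‖ₑ * ‖x‖ₑ ∂μ.meas :=
          lintegral_mono fun x => ι.le_opENorm x
      _ = ‖ι‖ₑ * ∫⁻ x in (Metric.closedBall 0 R)ᶜ, ‖x‖ₑ ∂μ.meas :=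
          lintegral_const_mul _ measurable_enorm
      _ ≤ (‖ι‖ₑ + 1) * (ε / (‖ι‖ₑ + 1)) := by
          gcongr
          · exact le_self_add
          · exact (h μ hμ).trans (min_le_right _ _)
      _ ≤ ε := ENNReal.mul_div_le

/-- The image of a second-moment ball under an injective operator mapping balls to compact sets is
compact for the Wasserstein distance. -/
theorem isCompact_setOf_exists_momentBall_map [SecondCountableTopology E]
    [SecondCountableTopology X] {ι : E →L[ℝ] X} (hι : Function.Injective ι)
    (hcomp : ∀ R, IsCompact (ι '' Metric.closedBall 0 R)) (c : ℝ≥0) :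
    IsCompact {ν : PSpace 1 X | ∃ μ ∈ momentBall E c, ν.meas = μ.meas.map ι} := by
  set S : Set (ProbabilityMeasure X) :=
    {ν | ∃ μ ∈ momentBall E c, (ν : Measure X) = μ.meas.map ι} with hS
  have hSclosed : IsClosed S := by
    simp_rw [hS, exists_momentBall_map_iff hι]
    exact isClosed_setOf_lintegral_measure_compl_le ι c
  have hScomp : IsCompact S := by
    rw [← hSclosed.closure_eq]
    refine isCompact_closure_of_isTightMeasureSet ?_
    refine isTightMeasureSet_iff_exists_isCompact_measure_compl_le.2 fun ε hε => ?_
    obtain ⟨C, hC, h⟩ := exists_isCompact_forall_tail_le hι hcomp c hε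
    refine ⟨C, hC, ?_⟩
    rintro _ ⟨ν, ⟨μ, hμ, hν⟩, rfl⟩
    rw [hν]
    exact (h μ hμ).1
  have hmom : ∀ ν ∈ S, ∫⁻ x, ‖x‖ₑ ^ (1 : ℝ) ∂(ν : Measure X) < ∞ := by
    rintro ν ⟨μ, hμ, hν⟩
    have hμ1 : ∫⁻ x, ‖x‖ₑ ∂μ.meas < ∞ := by simpa using μ.moment
    simp only [ENNReal.rpow_one]
    rw [hν, lintegral_map measurable_enorm ι.continuous.measurable]
    refine (lintegral_mono fun x => ι.le_opENorm x).trans_lt ?_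
    rw [lintegral_const_mul _ measurable_enorm]
    exact ENNReal.mul_lt_top enorm_lt_top hμ1
  -- The identity from the weak to the Wasserstein topology, continuous on `S` because the tails are
  -- uniform; the target set is its range.
  let g : S → PSpace 1 X := fun ν => ⟨ν.1, inferInstance, hmom ν ν.2⟩
  have hg : Continuous g := by
    refine continuous_iff_continuousAt.2 fun ν => ?_
    rw [ContinuousAt, tendsto_iff_dist_tendsto_zero]
    have htc := tendsto_transportCost_of_tendsto (μs := fun ν : S => ν.1)
      continuous_subtype_val.continuousAt (μ := ν.1) (L := 𝓝 ν) fun ε hε => by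
        obtain ⟨C, hC, h⟩ := exists_isCompact_forall_tail_le hι hcomp c hε
        have hall : ∀ ν : S, ∫⁻ x in Cᶜ, ‖x‖ₑ ∂(ν.1 : Measure X) ≤ ε := by
          rintro ⟨ν, μ, hμ, hν⟩
          rw [hν]
          exact (h μ hμ).2
        exact ⟨C, hC, hall ν, hall⟩
    exact (ENNReal.tendsto_toReal ENNReal.zero_ne_top).comp htc
  have := isCompact_iff_compactSpace.1 hScomp
  convert isCompact_range hg
  ext ν
  constructor
  · intro h
    exact ⟨⟨⟨ν.meas, ν.isProb⟩, h⟩, rfl⟩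
  · rintro ⟨⟨ν, h⟩, rfl⟩
    exact h

end Embedding

/-! ### Compactness of the embedding of $H$ into $H_{-1}$ -/

section WeakSpace

variable {H : Type*} [NormedAddCommGroup H] [InnerProductSpace ℝ H] [CompleteSpace H]

/-- The canonical embedding `H → H₋₁` as a continuous linear map. -/
noncomputable def toWeakL (B : StrictlyPositiveOperator H) : H →L[ℝ] WeakSpace B :=
  LinearMap.mkContinuous
    { toFun := toWeak B
      map_add' := fun x y => UniformSpace.Completion.coe_add (toPreWeak B x) (toPreWeak B y)
      map_smul' := fun r x => UniformSpace.Completion.coe_smul r (toPreWeak B x) }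
    (√‖B.op‖) (norm_toWeak_le B)

theorem toWeakL_injective (B : StrictlyPositiveOperator H) : Function.Injective (toWeakL B) :=
  fun _ _ h => UniformSpace.Completion.coe_injective (PreWeak B) h

theorem norm_toWeakL (B : StrictlyPositiveOperator H) (x : H) :
    ‖toWeakL B x‖ = √(inner ℝ (B.op x) x) :=
  (UniformSpace.Completion.norm_coe (toPreWeak B x)).trans (norm_toPreWeak B x)

/-- By $\|x-y\|_{-1}^2\le\|B(x-y)\|\,\|x-y\|$, a finite net for the image of the ball under `B.op`
yields one in $H_{-1}$. -/
theorem isCompact_image_toWeakL_closedBall (B : StrictlyPositiveOperator H)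
    (hB : IsCompactOperator B.op) (R : ℝ) : IsCompact (toWeakL B '' Metric.closedBall 0 R) := by
  refine TotallyBounded.isCompact_of_isClosed ?_ (isClosed_image_closedBall _ R)
  rcases lt_or_ge R 0 with hR | hR
  · simp [Metric.closedBall_eq_empty.2 hR]
  obtain ⟨K, hK, hBK⟩ :=
    IsCompactOperator.image_closedBall_subset_compact (f := (B.op : H →ₗ[ℝ] H)) hB R
  have htb : TotallyBounded (B.op '' Metric.closedBall 0 R) := hK.totallyBounded.subset hBK
  refine Metric.totallyBounded_iff.2 fun ε hε => ?_
  obtain ⟨t, hts, htf, ht⟩ := Metric.finite_approx_of_totallyBounded htb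
    -- $2R$ bounds $\|x-y\|$ on the ball; the $1$ keeps the denominator positive when $R=0$.
    (ε ^ 2 / (2 * R + 1)) (by positivity)
  obtain ⟨s, hs, hsf, rfl⟩ := Set.exists_subset_image_finite_and.1 ⟨t, hts, htf, rfl⟩
  refine ⟨toWeakL B '' s, hsf.image _, ?_⟩
  rintro _ ⟨x, hx, rfl⟩
  obtain ⟨_, ⟨y, hy, rfl⟩, hxy⟩ := mem_iUnion₂.1 (ht (mem_image_of_mem _ hx))
  refine mem_iUnion₂.2 ⟨_, mem_image_of_mem _ hy, ?_⟩
  rw [Metric.mem_ball, dist_eq_norm, ← map_sub, norm_toWeakL, Real.sqrt_lt' hε]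
  rw [Metric.mem_ball, dist_eq_norm, ← map_sub, lt_div_iff₀ (by positivity)] at hxy
  have hxR := mem_closedBall_zero_iff.1 hx
  have hyR := mem_closedBall_zero_iff.1 (hs hy)
  calc inner ℝ (B.op (x - y)) (x - y) ≤ ‖B.op (x - y)‖ * ‖x - y‖ := real_inner_le_norm _ _
    _ ≤ ‖B.op (x - y)‖ * (2 * R + 1) := by
        gcongr
        linarith [norm_sub_le x y]
    _ < ε ^ 2 := hxy

end WeakSpace

/-! ### Flows: compactness and convexity -/

section Flows

variable {H : Type*} [NormedAddCommGroup H] [InnerProductSpace ℝ H] [CompleteSpace H]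
  [MeasurableSpace H] [BorelSpace H]

theorem PSpace.toWeak_meas (B : StrictlyPositiveOperator H) (μ : PSpace 1 H) :
    (μ.toWeak B).meas = μ.meas.map (toWeakL B) := rfl

/-- Convex combinations in `𝒫_1(X)`. -/
noncomputable def PSpace.combo {X : Type*} [NormedAddCommGroup X] [MeasurableSpace X] {a b : ℝ≥0}
    (hab : a + b = 1) (μ ν : PSpace 1 X) : PSpace 1 X where
  meas := a • μ.meas + b • ν.meas
  isProb := ⟨by simpa using by exact_mod_cast hab⟩
  moment := by
    rw [lintegral_add_measure, lintegral_smul_measure, lintegral_smul_measure]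
    exact ENNReal.add_lt_top.2 ⟨ENNReal.mul_lt_top ENNReal.coe_lt_top μ.moment,
      ENNReal.mul_lt_top ENNReal.coe_lt_top ν.moment⟩

theorem PSpace.toWeak_combo (B : StrictlyPositiveOperator H) {a b : ℝ≥0} (hab : a + b = 1)
    (μ ν : PSpace 1 H) : (combo hab μ ν).toWeak B = combo hab (μ.toWeak B) (ν.toWeak B) := by
  refine PSpace.ext ?_
  simp only [combo, toWeak_meas]
  rw [Measure.map_add _ _ (toWeakL B).continuous.measurable, Measure.map_smul, Measure.map_smul]

variable [TopologicalSpace.SeparableSpace H]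

theorem isCompact_toWeak_image_momentBall (B : StrictlyPositiveOperator H)
    (hB : IsCompactOperator B.op) (c : ℝ≥0) :
    IsCompact (PSpace.toWeak B '' momentBall H c) := by
  have := UniformSpace.secondCountable_of_separable H
  convert isCompact_setOf_exists_momentBall_map (toWeakL_injective B)
    (isCompact_image_toWeakL_closedBall B hB) c using 1
  ext ν
  constructor
  · rintro ⟨μ, hμ, rfl⟩
    exact ⟨μ, hμ, rfl⟩
  · rintro ⟨μ, hμ, hν⟩
    exact ⟨μ, hμ, PSpace.ext hν.symm⟩

/-- Needed to recover the initial condition in $H$ from its image in $H_{-1}$. -/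
theorem map_toWeakL_injective (B : StrictlyPositiveOperator H) :
    Function.Injective (fun μ : Measure H => μ.map (toWeakL B)) := by
  have := UniformSpace.secondCountable_of_separable H
  have hemb := (toWeakL B).continuous.measurableEmbedding (toWeakL_injective B)
  intro μ ν h
  rw [← hemb.comap_map μ, ← hemb.comap_map ν]
  exact congrArg _ h

theorem tendsto_mul_sqrt_abs_sub (M : ℝ) (t : ℝ) :
    Tendsto (fun s : ℝ => M * √|t - s|) (𝓝 t) (𝓝 0) := by
  have : Continuous fun s : ℝ => M * √|t - s| := by fun_prop
  simpa using this.tendsto t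

theorem equicontinuous_of_dist_le_sqrt {Y J : Type*} [MetricSpace Y] {I : Set ℝ} {F : J → I → Y}
    {M : ℝ} (h : ∀ j s t, dist (F j t) (F j s) ≤ M * √|(t : ℝ) - s|) : Equicontinuous F :=
  fun t => Metric.equicontinuousAt_of_continuity_modulus (fun s : I => M * √|(t : ℝ) - s|)
    ((tendsto_mul_sqrt_abs_sub M t).comp continuous_subtype_val.continuousAt) F
    (Eventually.of_forall fun s j => h j s t)

theorem continuous_of_mem_holderFlows (B : StrictlyPositiveOperator H) {T : ℝ} (hT : 0 < T)
    {m₀ : PSpace 2 H} {c M : ℝ≥0} {m : Icc 0 T → PSpace 1 H} (hm : m ∈ holderFlows B hT m₀ c M) :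
    Continuous fun t => (m t).toWeak B :=
  (equicontinuous_of_dist_le_sqrt (F := fun (_ : Unit) t => (m t).toWeak B)
    fun _ => hm.2.2).continuous ()

theorem isCompact_holderFlowsInC (B : StrictlyPositiveOperator H) (hB : IsCompactOperator B.op)
    {T : ℝ} (hT : 0 < T) (m₀ : PSpace 2 H) (c M : ℝ≥0) :
    IsCompact (holderFlowsInC B hT m₀ c M) := by
  set K := PSpace.toWeak B '' momentBall H c with hK
  set S₀ : Set (PSpace 1 (WeakSpace B)) := {ν | ν.meas = m₀.meas.map (toWeakL B)} with hS₀
  have hS₀c : IsClosed S₀ := Set.Subsingleton.isClosed fun μ hμ ν hν => PSpace.ext (hμ.trans hν.symm)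
  set o : Icc 0 T := ⟨0, left_mem_Icc.2 hT.le⟩ with ho
  -- Given equicontinuity, compactness for pointwise convergence suffices: Tychonoff for the values,
  -- intersected with closed conditions.
  refine ArzelaAscoli.isCompact_of_equicontinuous _ ?_ ?_
  · have hpi : IsCompact (univ.pi fun _ : Icc 0 T => K) :=
      isCompact_univ_pi fun _ => isCompact_toWeak_image_momentBall B hB c
    have hcl : IsClosed {f : Icc 0 T → PSpace 1 (WeakSpace B) | f o ∈ S₀ ∧
        ∀ s t : Icc 0 T, dist (f t) (f s) ≤ M * √|(t : ℝ) - s|} := by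
      refine (hS₀c.preimage (f := fun f : Icc 0 T → PSpace 1 (WeakSpace B) => f o)
        (continuous_apply o)).inter ?_
      change IsClosed {f : Icc 0 T → PSpace 1 (WeakSpace B) |
        ∀ s t : Icc 0 T, dist (f t) (f s) ≤ M * √|(t : ℝ) - s|}
      simp only [ofPred_forall]
      exact isClosed_iInter fun s => isClosed_iInter fun t =>
        isClosed_le ((continuous_apply t).dist (continuous_apply s)) continuous_const
    convert hpi.inter_right hcl using 1
    ext f
    constructor
    · rintro ⟨f, ⟨m, hm, hf⟩, rfl⟩
      have hf' : f.toFun = fun t => (m t).toWeak B := funext hf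
      rw [hf']
      refine ⟨fun t _ => mem_image_of_mem _ (hm.1 t), ?_, hm.2.2⟩
      exact congrArg (Measure.map (toWeakL B)) hm.2.1
    · rintro ⟨hfK, hf0, hfM⟩
      -- The lifts to $H$ may be chosen time by time: the Hölder condition involves only their
      -- images in $H_{-1}$.
      choose m hmQ hm using fun t => hfK t (mem_univ t)
      have hmem : m ∈ holderFlows B hT m₀ c M := by
        refine ⟨hmQ, map_toWeakL_injective B ?_, fun s t => ?_⟩
        · exact (congrArg PSpace.meas (hm o)).trans hf0
        · rw [hm, hm]
          exact hfM s t
      exact ⟨⟨fun t => (m t).toWeak B, continuous_of_mem_holderFlows B hT hmem⟩,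
        ⟨m, hmem, fun _ => rfl⟩, funext hm⟩
  · refine equicontinuous_of_dist_le_sqrt (M := M) ?_
    rintro ⟨f, m, hm, hf⟩ s t
    change dist (f t) (f s) ≤ _
    rw [hf, hf]
    exact hm.2.2 s t

theorem PSpace.dist_combo_le {X : Type*} [NormedAddCommGroup X] [MeasurableSpace X]
    [BorelSpace X] [SecondCountableTopology X] [CompleteSpace X] {a b : ℝ≥0} (hab : a + b = 1)
    {μ μ' ν ν' : PSpace 1 X} {r : ℝ} (h : dist μ ν ≤ r) (h' : dist μ' ν' ≤ r) :
    dist (combo hab μ μ') (combo hab ν ν') ≤ r := by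
  have hne : ∀ μ ν : PSpace 1 X, (couplings μ.meas ν.meas).Nonempty := fun μ ν =>
    ⟨μ.meas.prod ν.meas, by simp [Measure.map_fst_prod], by simp [Measure.map_snd_prod]⟩
  have htc := ENNReal.toReal_mono (ENNReal.add_ne_top.2
    ⟨ENNReal.mul_ne_top ENNReal.coe_ne_top (transportCost_ne_top μ ν),
      ENNReal.mul_ne_top ENNReal.coe_ne_top (transportCost_ne_top μ' ν')⟩)
    (transportCost_add_smul_le a b (hne μ ν) (hne μ' ν'))
  rw [ENNReal.toReal_add (ENNReal.mul_ne_top ENNReal.coe_ne_top (transportCost_ne_top μ ν))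
    (ENNReal.mul_ne_top ENNReal.coe_ne_top (transportCost_ne_top μ' ν')), ENNReal.toReal_mul,
    ENNReal.toReal_mul, ENNReal.coe_toReal, ENNReal.coe_toReal] at htc
  calc dist (combo hab μ μ') (combo hab ν ν') ≤ a * dist μ ν + b * dist μ' ν' := htc
    _ ≤ a * r + b * r := by gcongr
    _ = r := by
        rw [← add_mul]
        have : (a : ℝ) + b = 1 := by exact_mod_cast hab
        rw [this, one_mul]

/-- The second moment is affine in the measure, the initial datum is shared, and the transport cost
is jointly convex. -/
theorem combo_mem_holderFlows (B : StrictlyPositiveOperator H) {T : ℝ} (hT : 0 < T)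
    {m₀ : PSpace 2 H} {c M : ℝ≥0} {a b : ℝ≥0} (hab : a + b = 1) {m m' : Icc 0 T → PSpace 1 H}
    (hm : m ∈ holderFlows B hT m₀ c M) (hm' : m' ∈ holderFlows B hT m₀ c M) :
    (fun t => PSpace.combo hab (m t) (m' t)) ∈ holderFlows B hT m₀ c M := by
  refine ⟨fun t => ?_, ?_, fun s t => ?_⟩
  · have h1 := hm.1 t
    have h2 := hm'.1 t
    simp only [momentBall, mem_ofPred_eq, PSpace.combo] at h1 h2 ⊢
    rw [lintegral_add_measure, lintegral_smul_measure, lintegral_smul_measure]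
    calc (a : ℝ≥0∞) * ∫⁻ x, ‖x‖ₑ ^ 2 ∂(m t).meas + b * ∫⁻ x, ‖x‖ₑ ^ 2 ∂(m' t).meas
        ≤ a * c + b * c := by gcongr
      _ = c := by
          rw [← add_mul]
          have : (a : ℝ≥0∞) + b = 1 := by exact_mod_cast hab
          rw [this, one_mul]
  · simp only [PSpace.combo]
    rw [hm.2.1, hm'.2.1, ← add_smul, hab, one_smul]
  · rw [PSpace.toWeak_combo, PSpace.toWeak_combo]
    exact PSpace.dist_combo_le hab (hm.2.2 s t) (hm'.2.2 s t)

theorem convex_toSignedFlow_image_holderFlowsInC (B : StrictlyPositiveOperator H) {T : ℝ}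
    (hT : 0 < T) (m₀ : PSpace 2 H) (c M : ℝ≥0) :
    Convex ℝ (toSignedFlow '' holderFlowsInC B hT m₀ c M) := by
  rintro _ ⟨f, ⟨m, hm, hf⟩, rfl⟩ _ ⟨g, ⟨m', hm', hg⟩, rfl⟩ a b ha hb hab
  lift a to ℝ≥0 using ha
  lift b to ℝ≥0 using hb
  have hab' : a + b = 1 := by exact_mod_cast hab
  have hmem := combo_mem_holderFlows B hT hab' hm hm'
  refine ⟨⟨_, continuous_of_mem_holderFlows B hT hmem⟩, ⟨_, hmem, fun _ => rfl⟩, ?_⟩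
  funext t
  change ((PSpace.combo hab' (m t) (m' t)).toWeak B).meas.toSignedMeasure =
    a • (f t).meas.toSignedMeasure + b • (g t).meas.toSignedMeasure
  simp only [PSpace.toWeak_combo, ← hf, ← hg]
  exact (Measure.toSignedMeasure_add _ _).trans
    (congrArg₂ _ (Measure.toSignedMeasure_smul _ _) (Measure.toSignedMeasure_smul _ _))

end Flows

end HilbertFlow

open HilbertFlow
theorem mainTheorem8 {H : Type*} [NormedAddCommGroup H] [InnerProductSpace ℝ H] [CompleteSpace H]
    [TopologicalSpace.SeparableSpace H] [MeasurableSpace H] [BorelSpace H]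
    (B : StrictlyPositiveOperator H) (hB : IsCompactOperator B.op)
    {T : ℝ} (hT : 0 < T) (m₀ : PSpace 2 H) (c M : ℝ≥0) :
    (∀ m ∈ holderFlows B hT m₀ c M, Continuous fun t => (m t).toWeak B) ∧
      Convex ℝ (toSignedFlow '' holderFlowsInC B hT m₀ c M) ∧
      IsCompact (holderFlowsInC B hT m₀ c M) :=
  ⟨fun _ hm => continuous_of_mem_holderFlows B hT hm,
    convex_toSignedFlow_image_holderFlowsInC B hT m₀ c M,
    isCompact_holderFlowsInC B hB hT m₀ c M⟩
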